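/- Let $(X,\mathcal B,\mu)$ be a probability space and let $T:X\to X$ be an invertible bimeasurable measure-preserving transformation (for instance, an ergodic one). Denote also by $T$ the unitary Koopman operator $Tf=f\circ T$ on the complex Hilbert space $L_2(X,\mathcal B,\mu)$. An eigenfunction of $T$ is a nonzero $f\in L_2$ with $Tf=\lambda f$ for some $\lambda\in\mathbb C$; a compact function is an $f\in L_2$ whose orbit $\{T^if: i\in\mathbb Z\}$ is precompact in $L_2$. The Kronecker algebra $\mathcal K\subset\mathcal B$ is the smallest $\sigma$-algebra with respect to which all eigenfunctions are measurable, and the compact factor $\mathcal K'\subset\mathcal B$ is the $\sigma$-algebra generated by all compact functions. (Elements of $L_2$ are defined up to null sets; in both definitions all $\mathcal B$-measurable representatives are taken, so that both $\sigma$-algebras contain all null sets of $\mathcal B$.) Then the compact factor coincides with the Kronecker algebra, $\mathcal K=\mathcal K'$. Moreover, the compact functions are exactly the elements of the closed linear span of the eigenfunctions in $L_2$. -/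

import Mathlib

open MeasureTheory

namespace Kronecker

variable {X : Type*} [MeasurableSpace X] {μ : Measure X}

theorem compMeasurePreserving_comp_cancel (S T : X → X) (hS : MeasurePreserving S μ μ)
    (hT : MeasurePreserving T μ μ) (h : ∀ x, S (T x) = x) (f : Lp ℂ 2 μ) :
    Lp.compMeasurePreserving T hT (Lp.compMeasurePreserving S hS f) = f := by
  apply Lp.ext
  have h1 := Lp.coeFn_compMeasurePreserving (Lp.compMeasurePreserving S hS f) hT
  have h2 := hT.quasiMeasurePreserving.ae_eq_comp (Lp.coeFn_compMeasurePreserving f hS)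
  filter_upwards [h1, h2] with x hx1 hx2
  rw [hx1, hx2]
  simp [h]

/-- The Koopman operator `f ↦ f ∘ T` of an invertible measure-preserving transformation, as a
unitary operator on the complex Hilbert space `L²(X, μ)`. -/
noncomputable def koopman (T : X ≃ᵐ X) (hT : MeasurePreserving T μ μ) :
    Lp ℂ 2 μ ≃ₗᵢ[ℂ] Lp ℂ 2 μ where
  toFun := Lp.compMeasurePreserving T hT
  invFun := Lp.compMeasurePreserving T.symm (hT.symm T)
  map_add' := map_add _
  map_smul' := (Lp.compMeasurePreservingₗ ℂ T hT).map_smul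
  left_inv := compMeasurePreserving_comp_cancel _ _ _ _ T.apply_symm_apply
  right_inv := compMeasurePreserving_comp_cancel _ _ _ _ T.symm_apply_apply
  norm_map' f := Lp.norm_compMeasurePreserving f hT

/-- The (nonzero) eigenvectors of the Koopman operator, for all eigenvalues. -/
def eigenvectors (T : X ≃ᵐ X) (hT : MeasurePreserving T μ μ) : Set (Lp ℂ 2 μ) :=
  {f | f ≠ 0 ∧ ∃ c : ℂ, koopman T hT f = c • f}

/-- The compact vectors: those `f ∈ L²` whose orbit `{Tⁱ f : i ∈ ℤ}` is precompact in `L²`. -/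
def compactVectors (T : X ≃ᵐ X) (hT : MeasurePreserving T μ μ) : Set (Lp ℂ 2 μ) :=
  {f | IsCompact (closure (Set.range fun i : ℤ => (koopman T hT ^ i) f))}

/-- The σ-algebra generated by a set `S` of elements of `L²`. As elements of `L²` are classes of
functions modulo null sets, this is the smallest σ-algebra for which every measurable function
representing an element of `S` is measurable. (It is contained in the ambient σ-algebra and, if `S`
is nonempty, it contains all its null sets.) -/
@[reducible]
noncomputable def generatedBy (S : Set (Lp ℂ 2 μ)) : MeasurableSpace X :=
  ⨆ g ∈ {g : X → ℂ | Measurable g ∧ ∃ f ∈ S, g =ᵐ[μ] f}, MeasurableSpace.comap g inferInstance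

/-- The Kronecker algebra: the smallest σ-algebra making all eigenfunctions measurable. -/
@[reducible]
noncomputable def kroneckerAlgebra (T : X ≃ᵐ X) (hT : MeasurePreserving T μ μ) : MeasurableSpace X :=
  generatedBy (eigenvectors T hT)

/-- The compact factor: the σ-algebra generated by the compact functions. -/
@[reducible]
noncomputable def compactFactor (T : X ≃ᵐ X) (hT : MeasurePreserving T μ μ) : MeasurableSpace X :=
  generatedBy (compactVectors T hT)

end Kronecker

/-! Eigenvalues of a unitary `U` have modulus one, so eigenvectors have precompact orbits, and
vectors with precompact orbit form a closed subspace. For the converse, remove from such a vector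
its projection to the closed span `M` of the eigenvectors; the rest `g` has a precompact orbit
inside `Mᗮ`. If `g ≠ 0`, a limit of averages of the rank-one operators of the vectors `(U ^ n) g` is
compact, symmetric, nonzero, commutes with `U` and has range in `Mᗮ`. Its eigenspace for a nonzero
eigenvalue is finite-dimensional and `U`-invariant, so it holds an eigenvector of `U` in `Mᗮ`, which
is absurd (`exists_eigenvector_of_totallyBounded_orbit`). The σ-algebras then agree because passing
to the closed span generates nothing new (`generatedBy_closure_span`). -/

open Filter Topology

namespace Kronecker

/-! ### Rank-one averages along an orbit and their limit operator -/

section Hilbert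

variable {H : Type*} [NormedAddCommGroup H] [InnerProductSpace ℂ H]

/-- The average of the rank-one operators `h ↦ ⟪x n, h⟫ x n` over `n ≤ N`. -/
noncomputable def rankOneAverage (x : ℕ → H) (N : ℕ) : H →ₗ[ℂ] H :=
  ((N : ℝ) + 1)⁻¹ • ∑ n ∈ Finset.range (N + 1), (innerₛₗ ℂ (x n)).smulRight (x n)

theorem rankOneAverage_apply (x : ℕ → H) (N : ℕ) (h : H) :
    rankOneAverage x N h =
      ((N : ℝ) + 1)⁻¹ • ∑ n ∈ Finset.range (N + 1), inner ℂ (x n) h • x n := by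
  simp [rankOneAverage]

/-- The averages are convex combinations. Used with a compact convex set to get limits, and with a
closed subspace to locate the range of the limit. -/
theorem rankOneAverage_mem_convex (x : ℕ → H) (N : ℕ) (h : H) {s : Set H} (hs : Convex ℝ s)
    (hxs : ∀ n, inner ℂ (x n) h • x n ∈ s) : rankOneAverage x N h ∈ s := by
  rw [rankOneAverage_apply, Finset.smul_sum]
  refine hs.sum_mem (fun _ _ => by positivity) ?_ fun n _ => hxs n
  simp only [Finset.sum_const, Finset.card_range, nsmul_eq_mul]
  push_cast
  exact mul_inv_cancel₀ (by positivity)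

theorem inner_rankOneAverage_left (x : ℕ → H) (N : ℕ) (h k : H) :
    inner ℂ (rankOneAverage x N h) k =
      ((N : ℝ) + 1)⁻¹ • ∑ n ∈ Finset.range (N + 1), inner ℂ h (x n) * inner ℂ (x n) k := by
  rw [rankOneAverage_apply, ← Complex.coe_smul, inner_smul_left, sum_inner, Complex.conj_ofReal,
    ← smul_eq_mul, Complex.coe_smul]
  simp [inner_smul_left]

theorem isSymmetric_rankOneAverage (x : ℕ → H) (N : ℕ) : (rankOneAverage x N).IsSymmetric := by
  intro h k
  rw [inner_rankOneAverage_left, ← inner_conj_symm h, inner_rankOneAverage_left, Complex.real_smul,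
    Complex.real_smul, map_mul, Complex.conj_ofReal, map_sum]
  congr 1
  refine Finset.sum_congr rfl fun n _ => ?_
  rw [map_mul, inner_conj_symm, inner_conj_symm, mul_comm]

/-- A compact convex set containing all the vectors `⟪x n, h⟫ x n` with `‖h‖ ≤ R`. -/
theorem exists_compact_convex [CompleteSpace H] {x : ℕ → H} (hx : TotallyBounded (Set.range x))
    {r : ℝ} (hr : ∀ n, ‖x n‖ = r) (R : ℝ) :
    ∃ C : Set H, IsCompact C ∧ Convex ℝ C ∧ ∀ h, ‖h‖ ≤ R → ∀ n, inner ℂ (x n) h • x n ∈ C := by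
  have hr0 : 0 ≤ r := hr 0 ▸ norm_nonneg _
  have hK : IsCompact (closure (Set.range x)) := hx.closure.isCompact_of_isClosed isClosed_closure
  have hS := ((isCompact_closedBall (0 : ℂ) (r * R)).prod hK).image
    (continuous_fst.smul continuous_snd)
  refine ⟨closure (convexHull ℝ _), hS.totallyBounded.convexHull.closure.isCompact_of_isClosed
    isClosed_closure, (convex_convexHull ℝ _).closure, fun h hh n => ?_⟩
  refine subset_closure (subset_convexHull ℝ _ ⟨(inner ℂ (x n) h, x n), ⟨?_, ?_⟩, rfl⟩)
  · rw [mem_closedBall_zero_iff]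
    calc ‖inner ℂ (x n) h‖ ≤ ‖x n‖ * ‖h‖ := norm_inner_le_norm _ _
      _ ≤ r * R := by rw [hr]; gcongr
  · exact subset_closure ⟨n, rfl⟩

/-- The averages of the rank-one operators along a totally bounded sequence converge, along an
ultrafilter, to a compact operator. -/
theorem exists_limit_rankOneAverage [CompleteSpace H] {x : ℕ → H}
    (hx : TotallyBounded (Set.range x)) {r : ℝ} (hr : ∀ n, ‖x n‖ = r) :
    ∃ A : H →L[ℂ] H, IsCompactOperator A ∧
      ∀ h, Tendsto (fun N => rankOneAverage x N h) (hyperfilter ℕ) (𝓝 (A h)) := by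
  have hex (R : ℝ) : ∃ C : Set H, IsCompact C ∧ ∀ h, ‖h‖ ≤ R → ∀ N, rankOneAverage x N h ∈ C := by
    obtain ⟨C, hC, hconv, hmem⟩ := exists_compact_convex hx hr R
    exact ⟨C, hC, fun h hh N => rankOneAverage_mem_convex x N h hconv (hmem h hh)⟩
  have hlim (h : H) :
      ∃ y, Tendsto (fun N => rankOneAverage x N h) (hyperfilter ℕ) (𝓝 y) := by
    obtain ⟨C, hC, hmem⟩ := hex ‖h‖
    -- One ultrafilter serves every `h` at once, so the pointwise limit is linear.
    obtain ⟨y, -, hy⟩ := hC.ultrafilter_le_nhds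
      ((hyperfilter ℕ).map fun N => rankOneAverage x N h)
      (tendsto_principal.2 (Eventually.of_forall (hmem h le_rfl)))
    exact ⟨y, hy⟩
  choose A hA using hlim
  let L : H →ₗ[ℂ] H :=
    { toFun := A
      map_add' := fun h k => tendsto_nhds_unique (hA (h + k))
        (by simpa only [map_add] using (hA h).add (hA k))
      map_smul' := fun c h => tendsto_nhds_unique (hA (c • h))
        (by simpa only [map_smul, RingHom.id_apply] using (hA h).const_smul c) }
  have hL : IsCompactOperator L := by
    obtain ⟨C, hC, hmem⟩ := hex 1
    refine (isCompactOperator_iff_image_closedBall_subset_compact L one_pos).2 ⟨C, hC, ?_⟩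
    rintro _ ⟨h, hh, rfl⟩
    exact hC.isClosed.mem_of_tendsto (hA h)
      (Eventually.of_forall (hmem h (mem_closedBall_zero_iff.1 hh)))
  exact ⟨⟨L, hL.continuous⟩, hL, hA⟩

/-- Conjugation by `U` shifts the sum by one index, so the commutator telescopes to two bounded
terms divided by `N + 1`. -/
theorem limit_rankOneAverage_commute {x : ℕ → H} {r : ℝ} (hr : ∀ n, ‖x n‖ = r)
    (U : H ≃ₗᵢ[ℂ] H) (hU : ∀ n, U (x n) = x (n + 1)) {A : H →L[ℂ] H}
    (hA : ∀ h, Tendsto (fun N => rankOneAverage x N h) (hyperfilter ℕ) (𝓝 (A h))) (h : H) :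
    A (U h) = U (A h) := by
  let b : ℕ → H := fun n => inner ℂ (x n) (U h) • x n
  have hb (n : ℕ) : ‖b n‖ ≤ r * ‖h‖ * r := by
    have := norm_inner_le_norm (𝕜 := ℂ) (x n) (U h)
    have hr0 : 0 ≤ r := hr 0 ▸ norm_nonneg _
    rw [hr, U.norm_map] at this
    rw [norm_smul, hr]
    gcongr
  have hdiff (N : ℕ) : U (rankOneAverage x N h) - rankOneAverage x N (U h) =
      ((N : ℝ) + 1)⁻¹ • (b (N + 1) - b 0) := by
    rw [rankOneAverage_apply, rankOneAverage_apply, ← Finset.sum_range_sub, Finset.sum_sub_distrib,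
      smul_sub, ← Complex.coe_smul, map_smul, map_sum, Complex.coe_smul]
    congr 2
    refine Finset.sum_congr rfl fun n _ => ?_
    simp only [b, map_smul, hU]
    rw [← hU, U.inner_map_map]
  have hzero : Tendsto (fun N : ℕ => ((N : ℝ) + 1)⁻¹ • (b (N + 1) - b 0)) atTop (𝓝 0) := by
    refine squeeze_zero_norm (a := fun N : ℕ => 1 / ((N : ℝ) + 1) * (2 * (r * ‖h‖ * r)))
      (fun N => ?_) ?_
    · rw [norm_smul, Real.norm_of_nonneg (by positivity), one_div]
      gcongr
      calc _ ≤ _ := norm_sub_le _ _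
        _ ≤ _ := by linarith [hb (N + 1), hb 0]
    · simpa using (tendsto_one_div_add_atTop_nhds_zero_nat (𝕜 := ℝ)).mul_const (2 * (r * ‖h‖ * r))
  have h1 := ((U.continuous.tendsto _).comp (hA h)).sub (hA (U h))
  have h2 := hzero.mono_left (Nat.hyperfilter_le_atTop)
  simp only [← hdiff] at h2
  exact (sub_eq_zero.1 (tendsto_nhds_unique h1 h2)).symm

/-- Each `x n` is within `r / 2` of some `y` in a finite net, whence `|⟪x n, y⟫| ≥ r² - r · r/2 =
r²/2`. Summed over the net, the quadratic forms of the averages stay bounded below. -/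
theorem limit_rankOneAverage_ne_zero {x : ℕ → H} (hx : TotallyBounded (Set.range x))
    {r : ℝ} (hr : ∀ n, ‖x n‖ = r) (hr0 : 0 < r) {A : H →L[ℂ] H}
    (hA : ∀ h, Tendsto (fun N => rankOneAverage x N h) (hyperfilter ℕ) (𝓝 (A h))) : A ≠ 0 := by
  rintro rfl
  obtain ⟨t, htf, ht⟩ := Metric.totallyBounded_iff.1 hx (r / 2) (by positivity)
  let F : Finset H := htf.toFinset
  have hlim : Tendsto (fun N => ∑ y ∈ F, RCLike.re (inner ℂ (rankOneAverage x N y) y))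
      (hyperfilter ℕ) (𝓝 0) := by
    have : Tendsto (fun N => ∑ y ∈ F, RCLike.re (inner ℂ (rankOneAverage x N y) y))
        (hyperfilter ℕ) (𝓝 (∑ y ∈ F, RCLike.re (inner ℂ ((0 : H →L[ℂ] H) y) y))) :=
      tendsto_finsetSum _ fun y _ =>
        (RCLike.continuous_re.tendsto _).comp ((hA y).inner tendsto_const_nhds)
    simpa using this
  have hre (N : ℕ) (y : H) : RCLike.re (inner ℂ (rankOneAverage x N y) y) =
      ((N : ℝ) + 1)⁻¹ * ∑ n ∈ Finset.range (N + 1), ‖inner ℂ (x n) y‖ ^ 2 := by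
    rw [inner_rankOneAverage_left, RCLike.smul_re, map_sum]
    congr 1
    refine Finset.sum_congr rfl fun n _ => ?_
    rw [← inner_conj_symm, RCLike.conj_mul]
    norm_cast
  have hlow (n : ℕ) : (r ^ 2 / 2) ^ 2 ≤ ∑ y ∈ F, ‖inner ℂ (x n) y‖ ^ 2 := by
    obtain ⟨y, hy, hxy⟩ := Set.mem_iUnion₂.1 (ht ⟨n, rfl⟩)
    have hyF : y ∈ F := htf.mem_toFinset.2 hy
    refine le_trans ?_ (Finset.single_le_sum (f := fun y => ‖inner ℂ (x n) y‖ ^ 2)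
      (fun _ _ => by positivity) hyF)
    have h1 : inner ℂ (x n) (x n) = inner ℂ (x n) y + inner ℂ (x n) (x n - y) := by
      rw [← inner_add_right, add_sub_cancel]
    have h2 : r ^ 2 ≤ ‖inner ℂ (x n) y‖ + r * (r / 2) := by
      calc r ^ 2 = ‖inner ℂ (x n) (x n)‖ := by
            rw [inner_self_eq_norm_sq_to_K, hr]; simp
        _ ≤ ‖inner ℂ (x n) y‖ + ‖inner ℂ (x n) (x n - y)‖ := by rw [h1]; exact norm_add_le _ _
        _ ≤ ‖inner ℂ (x n) y‖ + ‖x n‖ * ‖x n - y‖ := by gcongr; exact norm_inner_le_norm _ _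
        _ ≤ _ := by
          rw [hr]; gcongr
          rw [← dist_eq_norm]; exact (Metric.mem_ball.1 hxy).le
    gcongr
    linarith
  have hge (N : ℕ) :
      (r ^ 2 / 2) ^ 2 ≤ ∑ y ∈ F, RCLike.re (inner ℂ (rankOneAverage x N y) y) := by
    simp only [hre]
    rw [← Finset.mul_sum, Finset.sum_comm]
    calc (r ^ 2 / 2) ^ 2 =
        ((N : ℝ) + 1)⁻¹ * ∑ n ∈ Finset.range (N + 1), (r ^ 2 / 2) ^ 2 := by
          rw [Finset.sum_const, Finset.card_range, nsmul_eq_mul]; push_cast; field_simp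
      _ ≤ _ := by gcongr with n _; exact hlow n
  have := ge_of_tendsto hlim (Eventually.of_forall hge)
  have : 0 < (r ^ 2 / 2) ^ 2 := by positivity
  linarith

/-- A nonzero vector with precompact orbit under a unitary operator has an eigenvector in each
closed subspace containing its orbit. -/
theorem exists_eigenvector_of_totallyBounded_orbit [CompleteSpace H] (U : H ≃ₗᵢ[ℂ] H) {g : H}
    (hg : g ≠ 0) (htb : TotallyBounded (Set.range fun i : ℤ => (U ^ i) g)) (V : Submodule ℂ H)
    (hV : IsClosed (V : Set H)) (hgV : ∀ i : ℤ, (U ^ i) g ∈ V) :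
    ∃ v ∈ V, v ≠ 0 ∧ ∃ c : ℂ, U v = c • v := by
  let x : ℕ → H := fun n => (U ^ (n : ℤ)) g
  have hx : TotallyBounded (Set.range x) :=
    htb.subset (Set.range_comp_subset_range (fun n : ℕ => (n : ℤ)) fun i => (U ^ i) g)
  have hr (n : ℕ) : ‖x n‖ = ‖g‖ := (U ^ (n : ℤ)).norm_map g
  have hU (n : ℕ) : U (x n) = x (n + 1) := by
    simp only [x]
    push_cast
    rw [add_comm, zpow_one_add]
    rfl
  obtain ⟨A, hAc, hA⟩ := exists_limit_rankOneAverage hx hr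
  have hcomm := limit_rankOneAverage_commute hr U hU hA
  have hA0 := limit_rankOneAverage_ne_zero hx hr (norm_pos_iff.2 hg) hA
  have hsymm : A.IsSymmetric := fun h k =>
    tendsto_nhds_unique ((hA h).inner (𝕜 := ℂ) tendsto_const_nhds)
      ((tendsto_const_nhds.inner (𝕜 := ℂ) (hA k)).congr fun N =>
        (isSymmetric_rankOneAverage x N h k).symm)
  have hAV (h : H) : A h ∈ V := hV.mem_of_tendsto (hA h) <| Eventually.of_forall fun N =>
    rankOneAverage_mem_convex x N h (V.restrictScalars ℝ).convex
      fun n => V.smul_mem _ (hgV n)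
  obtain ⟨c, hc, hc0⟩ : ∃ c, Module.End.HasEigenvalue (A : Module.End ℂ H) c ∧ c ≠ 0 := by
    by_contra! hcon
    exact hA0 ((ContinuousLinearMap.eq_zero_of_forall_hasEigenvalue_eq_zero hAc hsymm).1 hcon)
  let E := Module.End.eigenspace (A : Module.End ℂ H) c
  have : FiniteDimensional ℂ E :=
    ContinuousLinearMap.finite_dimensional_eigenspace hAc c hc0
  have : Nontrivial E := Submodule.nontrivial_iff_ne_bot.2 hc
  have hE : ∀ v ∈ E, (U.toLinearEquiv : H →ₗ[ℂ] H) v ∈ E := by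
    intro v hv
    rw [Module.End.mem_eigenspace_iff] at hv ⊢
    change A (U v) = c • U v
    rw [hcomm, ← map_smul]
    exact congrArg U hv
  obtain ⟨d, hd⟩ := Module.End.exists_eigenvalue ((U.toLinearEquiv : H →ₗ[ℂ] H).restrict hE)
  obtain ⟨v, hv⟩ := hd.exists_hasEigenvector
  have hAv : A v = c • (v : H) := Module.End.mem_eigenspace_iff.1 v.2
  refine ⟨v, ?_, fun h0 => hv.2 (Subtype.ext h0), d, congrArg Subtype.val hv.apply_eq_smul⟩
  -- Since `c ≠ 0`, `v = c⁻¹ • A v` lies in the range of `A`, hence in `V`.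
  have := V.smul_mem c⁻¹ (hAV v)
  rwa [hAv, smul_smul, inv_mul_cancel₀ hc0, one_smul] at this

/-! ### Almost periodic vectors and the closed span of eigenvectors -/

/-- The vectors with totally bounded orbit under a unitary operator form a subspace. -/
def almostPeriodic [CompleteSpace H] (U : H ≃ₗᵢ[ℂ] H) : Submodule ℂ H where
  carrier := {f | TotallyBounded (Set.range fun i : ℤ => (U ^ i) f)}
  zero_mem' := by
    refine (Set.finite_singleton (0 : H)).totallyBounded.subset ?_
    rintro _ ⟨i, rfl⟩
    simp
  add_mem' {f g} hf hg := by
    have hc {k : H} (hk : TotallyBounded (Set.range fun i : ℤ => (U ^ i) k)) :=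
      hk.closure.isCompact_of_isClosed isClosed_closure
    refine (((hc hf).prod (hc hg)).image continuous_add).totallyBounded.subset ?_
    rintro _ ⟨i, rfl⟩
    exact ⟨((U ^ i) f, (U ^ i) g), ⟨subset_closure ⟨i, rfl⟩, subset_closure ⟨i, rfl⟩⟩,
      (map_add _ _ _).symm⟩
  smul_mem' c f hf := by
    refine (hf.image (uniformContinuous_const_smul c)).subset ?_
    rintro _ ⟨i, rfl⟩
    exact ⟨(U ^ i) f, ⟨i, rfl⟩, (map_smul _ _ _).symm⟩

theorem mem_almostPeriodic [CompleteSpace H] {U : H ≃ₗᵢ[ℂ] H} {f : H} :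
    f ∈ almostPeriodic U ↔ TotallyBounded (Set.range fun i : ℤ => (U ^ i) f) := Iff.rfl

/-- The powers of `U` are isometries, so orbits of close vectors stay uniformly close and share a
finite net. -/
theorem isClosed_almostPeriodic [CompleteSpace H] (U : H ≃ₗᵢ[ℂ] H) :
    IsClosed (almostPeriodic U : Set H) := by
  refine isClosed_of_closure_subset fun f hf => ?_
  refine Metric.totallyBounded_iff.2 fun ε hε => ?_
  obtain ⟨g, hg, hfg⟩ := Metric.mem_closure_iff.1 hf (ε / 2) (half_pos hε)
  obtain ⟨t, ht, hcov⟩ := Metric.totallyBounded_iff.1 (mem_almostPeriodic.1 hg) (ε / 2)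
    (half_pos hε)
  refine ⟨t, ht, ?_⟩
  rintro _ ⟨i, rfl⟩
  obtain ⟨y, hy, hgy⟩ := Set.mem_iUnion₂.1 (hcov ⟨i, rfl⟩)
  refine Set.mem_iUnion₂.2 ⟨y, hy, ?_⟩
  have h1 : dist ((U ^ i) f) ((U ^ i) g) < ε / 2 := by rwa [(U ^ i).dist_map]
  have h2 : dist ((U ^ i) g) y < ε / 2 := hgy
  change dist ((U ^ i) f) y < ε
  linarith [dist_triangle ((U ^ i) f) ((U ^ i) g) y]

theorem norm_eq_one_and_zpow_apply_of_eigenvector {U : H ≃ₗᵢ[ℂ] H} {f : H} (hf : f ≠ 0) {c : ℂ}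
    (hc : U f = c • f) (i : ℤ) : ‖c‖ = 1 ∧ (U ^ i) f = c ^ i • f := by
  have hnorm : ‖c‖ = 1 := by
    have := U.norm_map f
    rw [hc, norm_smul] at this
    exact mul_right_cancel₀ (norm_ne_zero_iff.2 hf) (this.trans (one_mul _).symm)
  have hc0 : c ≠ 0 := norm_ne_zero_iff.1 (by simp [hnorm])
  have hinv : U⁻¹ f = c⁻¹ • f := by
    have : U (c⁻¹ • f) = f := by rw [map_smul, hc, smul_smul, inv_mul_cancel₀ hc0, one_smul]
    exact U.symm_apply_eq.2 this.symm
  refine ⟨hnorm, ?_⟩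
  induction i with
  | zero => simp
  | succ n ih =>
    rw [add_comm, zpow_one_add, LinearIsometryEquiv.coe_mul, Function.comp_apply, ih, map_smul,
      hc, smul_smul, mul_comm,
      zpow_one_add₀ hc0]
  | pred n ih =>
    rw [sub_eq_add_neg, add_comm, zpow_add, zpow_neg_one, LinearIsometryEquiv.coe_mul,
      Function.comp_apply, ih, map_smul, hinv, smul_smul, mul_comm, zpow_add₀ hc0, zpow_neg_one]

theorem eigenvector_mem_almostPeriodic [CompleteSpace H] {U : H ≃ₗᵢ[ℂ] H} {f : H}
    (hf : f ≠ 0) {c : ℂ} (hc : U f = c • f) : f ∈ almostPeriodic U := by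
  refine (((isCompact_closedBall (0 : ℂ) 1).image
    (continuous_id.smul continuous_const : Continuous fun z : ℂ => z • f)).totallyBounded).subset ?_
  rintro _ ⟨i, rfl⟩
  obtain ⟨hn, hi⟩ := norm_eq_one_and_zpow_apply_of_eigenvector hf hc i
  exact ⟨c ^ i, by simp [hn], hi.symm⟩

/-- The almost periodic vectors of a unitary operator are the closed span of its eigenvectors. -/
theorem almostPeriodic_eq_topologicalClosure_span [CompleteSpace H] (U : H ≃ₗᵢ[ℂ] H) :
    almostPeriodic U =
      (Submodule.span ℂ {f : H | f ≠ 0 ∧ ∃ c : ℂ, U f = c • f}).topologicalClosure := by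
  set S : Set H := {f : H | f ≠ 0 ∧ ∃ c : ℂ, U f = c • f}
  set M := (Submodule.span ℂ S).topologicalClosure with hM
  have hMclosed : IsClosed (M : Set H) := Submodule.isClosed_topologicalClosure _
  have : CompleteSpace M := hMclosed.completeSpace_coe
  have hSM : S ⊆ M := Submodule.subset_span.trans (Submodule.le_topologicalClosure _)
  have hle : M ≤ almostPeriodic U :=
    Submodule.topologicalClosure_minimal _
      (Submodule.span_le.2 fun f ⟨hf, c, hc⟩ => eigenvector_mem_almostPeriodic hf hc)
      (isClosed_almostPeriodic U)
  refine le_antisymm (fun f hf => ?_) hle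
  set g := f - M.starProjection f with hg
  have hgM : g ∈ Mᗮ := M.sub_starProjection_mem_orthogonal f
  have hPf : M.starProjection f ∈ M := M.starProjection_apply_mem f
  by_cases hg0 : g = 0
  · rw [sub_eq_zero.1 (hg.symm.trans hg0)]
    exact hPf
  have horb (i : ℤ) : (U ^ i) g ∈ Mᗮ := by
    -- `⟪(U ^ i) g, (U ^ i) v⟫ = ⟪g, v⟫ = 0`, and `(U ^ i) v` is a nonzero multiple of `v`.
    have hspan : Submodule.span ℂ S ≤ (ℂ ∙ (U ^ i) g)ᗮ := by
      refine Submodule.span_le.2 fun v ⟨hv, c, hc⟩ => ?_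
      rw [SetLike.mem_coe, Submodule.mem_orthogonal_singleton_iff_inner_right]
      obtain ⟨hn, hi⟩ := norm_eq_one_and_zpow_apply_of_eigenvector hv hc i
      have hci : c ^ i ≠ 0 := zpow_ne_zero _ (norm_ne_zero_iff.1 (by simp [hn]))
      have h0 : inner ℂ ((U ^ i) g) ((U ^ i) v) = 0 := by
        rw [LinearIsometryEquiv.inner_map_map]
        exact Submodule.inner_left_of_mem_orthogonal (hSM ⟨hv, c, hc⟩) hgM
      rw [hi, inner_smul_right] at h0
      exact (mul_eq_zero.1 h0).resolve_left hci
    have hMle : M ≤ (ℂ ∙ (U ^ i) g)ᗮ :=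
      Submodule.topologicalClosure_minimal _ hspan (Submodule.isClosed_orthogonal _)
    refine (Submodule.mem_orthogonal' _ _).2 fun u hu => ?_
    exact Submodule.mem_orthogonal_singleton_iff_inner_right.1 (hMle hu)
  obtain ⟨v, hv, hv0, c, hc⟩ := exists_eigenvector_of_totallyBounded_orbit U hg0
    ((almostPeriodic U).sub_mem hf (hle hPf)) Mᗮ (Submodule.isClosed_orthogonal _) horb
  exact absurd (inner_self_eq_zero.1
    (Submodule.inner_right_of_mem_orthogonal (hSM ⟨hv0, c, hc⟩) hv)) hv0

end Hilbert

/-! ### Generated σ-algebras and null sets -/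

section Measurability

variable {X : Type*} [MeasurableSpace X] {μ : Measure X}

theorem compactVectors_eq_closure_span (T : X ≃ᵐ X) (hT : MeasurePreserving T μ μ) :
    compactVectors T hT = closure (Submodule.span ℂ (eigenvectors T hT) : Set (Lp ℂ 2 μ)) := by
  have h := congrArg (SetLike.coe) (almostPeriodic_eq_topologicalClosure_span (koopman T hT))
  rw [Submodule.topologicalClosure_coe] at h
  refine Eq.trans (Set.ext fun f => ?_) h
  refine ⟨fun hf => hf.totallyBounded.subset subset_closure, fun hf => ?_⟩
  exact (TotallyBounded.closure hf).isCompact_of_isClosed isClosed_closure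

theorem measurable_generatedBy {S : Set (Lp ℂ 2 μ)} {g : X → ℂ} (hg : Measurable g)
    {f : Lp ℂ 2 μ} (hf : f ∈ S) (hgf : g =ᵐ[μ] f) : Measurable[generatedBy S] g :=
  Measurable.of_comap_le (le_iSup₂_of_le g ⟨hg, f, hf, hgf⟩ le_rfl)

theorem generatedBy_le {X : Type*} {m mX : MeasurableSpace X} {μ : Measure X}
    (S : Set (Lp ℂ 2 μ))
    (h : ∀ g : X → ℂ, Measurable g → ∀ f ∈ S, g =ᵐ[μ] f → Measurable[m] g) :
    generatedBy S ≤ m :=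
  iSup₂_le fun g ⟨hg, f, hf, hgf⟩ => (h g hg f hf hgf).comap_le

theorem generatedBy_le_ambient (S : Set (Lp ℂ 2 μ)) : generatedBy S ≤ ‹MeasurableSpace X› :=
  generatedBy_le S fun _ hg _ _ _ => hg

theorem generatedBy_mono {S S' : Set (Lp ℂ 2 μ)} (h : S ⊆ S') : generatedBy S ≤ generatedBy S' :=
  generatedBy_le S fun _ hg _ hf => measurable_generatedBy hg (h hf)

/-- The σ-algebra generated by a nonempty set of elements of `L²` contains the null sets. -/
theorem measurableSet_generatedBy_of_null {S : Set (Lp ℂ 2 μ)} (hS : S.Nonempty) {N : Set X}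
    (hN : MeasurableSet N) (hμ : μ N = 0) : MeasurableSet[generatedBy S] N := by
  obtain ⟨f, hf⟩ := hS
  obtain ⟨g, hg, hfg⟩ := (Lp.aestronglyMeasurable f).aemeasurable
  have hind : Measurable (N.indicator (1 : X → ℂ)) := measurable_const.indicator hN
  have h0 : N.indicator (1 : X → ℂ) =ᵐ[μ] 0 := indicator_meas_zero hμ
  -- `g` and `g + 1_N` represent the same class, so their difference `1_N` is measurable.
  have h1 := measurable_generatedBy hg hf hfg.symm
  have h2 := measurable_generatedBy (hg.add hind) hf (by
    filter_upwards [hfg, h0] with x hx hx0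
    simp [hx0, hx])
  have h3 : Measurable[generatedBy S] (N.indicator (1 : X → ℂ)) := by
    have := h2.sub h1
    rwa [add_sub_cancel_left] at this
  have h4 := h3 (measurableSet_singleton (1 : ℂ))
  convert h4 using 1
  ext x
  by_cases hx : x ∈ N <;> simp [hx]

theorem measurable_of_ae_eq_of_null {X : Type*} {m mX : MeasurableSpace X} {μ : Measure X}
    (hm : ∀ N : Set X, MeasurableSet N → μ N = 0 → MeasurableSet[m] N)
    (hle : m ≤ mX) {g g' : X → ℂ} (hg : Measurable g) (hg' : Measurable[m] g')
    (h : g =ᵐ[μ] g') : Measurable[m] g := by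
  intro s hs
  have hN : MeasurableSet {x | g x ≠ g' x} :=
    (measurableSet_eq_fun hg (hg'.mono hle le_rfl)).compl
  have hN0 : μ {x | g x ≠ g' x} = 0 := h
  have : g ⁻¹' s = (g' ⁻¹' s \ {x | g x ≠ g' x}) ∪ (g ⁻¹' s ∩ {x | g x ≠ g' x}) := by
    ext x
    by_cases hx : g x = g' x <;> simp [hx]
  rw [this]
  exact ((hg' hs).diff (hm _ hN hN0)).union
    (hm _ ((hg hs).inter hN) (measure_mono_null Set.inter_subset_right hN0))

/-- Classes with a `generatedBy S`-measurable version form a closed subspace. The null sets,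
available because `S` is nonempty, extend measurability to every representative. -/
theorem generatedBy_closure_span {S : Set (Lp ℂ 2 μ)} (hS : S.Nonempty) :
    generatedBy (closure (Submodule.span ℂ S : Set (Lp ℂ 2 μ))) = generatedBy S := by
  refine le_antisymm ?_ (generatedBy_mono (Submodule.subset_span.trans subset_closure))
  have hle := generatedBy_le_ambient S
  have hspan : Submodule.span ℂ S ≤ lpMeas ℂ ℂ (generatedBy S) 2 μ := by
    refine Submodule.span_le.2 fun f hf => mem_lpMeas_iff_aestronglyMeasurable.2 ?_
    obtain ⟨g, hg, hfg⟩ := (Lp.aestronglyMeasurable f).aemeasurable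
    exact ⟨g, (measurable_generatedBy hg hf hfg.symm).stronglyMeasurable, hfg⟩
  refine generatedBy_le _ fun g hg f hf hgf => ?_
  obtain ⟨g', hg', hfg'⟩ : AEStronglyMeasurable[generatedBy S] f μ :=
    closure_minimal (t := {f : Lp ℂ 2 μ | AEStronglyMeasurable[generatedBy S] f μ})
      (fun f hf => mem_lpMeas_iff_aestronglyMeasurable.1 (hspan hf))
      (isClosed_aestronglyMeasurable hle) hf
  exact measurable_of_ae_eq_of_null (fun _ => measurableSet_generatedBy_of_null hS) hle hg
    hg'.measurable (hgf.trans hfg')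

/-- The constant `1` is invariant, and nonzero because the total mass is one. -/
theorem eigenvectors_nonempty [IsProbabilityMeasure μ] (T : X ≃ᵐ X)
    (hT : MeasurePreserving T μ μ) : (eigenvectors T hT).Nonempty := by
  refine ⟨Lp.const 2 μ (1 : ℂ), ?_, 1, ?_⟩
  · rw [← norm_ne_zero_iff, Lp.norm_const _ _ _ two_ne_zero]
    simp
  · rw [one_smul]
    apply Lp.ext
    have h := Lp.coeFn_const (p := 2) (μ := μ) (1 : ℂ)
    exact (Lp.coeFn_compMeasurePreserving _ hT).trans
      ((hT.quasiMeasurePreserving.ae_eq_comp h).trans h.symm)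

end Measurability

end Kronecker

theorem theorem10p1 {X : Type*} [MeasurableSpace X] (μ : Measure X) [IsProbabilityMeasure μ]
    (T : X ≃ᵐ X) (hT : MeasurePreserving T μ μ) :
    Kronecker.kroneckerAlgebra T hT = Kronecker.compactFactor T hT ∧
    Kronecker.compactVectors T hT =
      closure (Submodule.span ℂ (Kronecker.eigenvectors T hT) : Set (Lp ℂ 2 μ)) := by
  have h := Kronecker.compactVectors_eq_closure_span T hT
  refine ⟨?_, h⟩
  rw [Kronecker.compactFactor, h]
  exact (Kronecker.generatedBy_closure_span (Kronecker.eigenvectors_nonempty T hT)).symm
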